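/- Let $n\ge 0$, let $\mathcal A_k=\{0,\dots,d_k-1\}$ with $d_k\ge 1$ and let $\mathcal X_k$ be a finite set ($k=1,\dots,n$); put $\mathcal A=\prod_k\mathcal A_k$, $\mathcal X=\prod_k\mathcal X_k$. A function $\bm w=(w_k)_k:\mathcal A\to\mathcal X$ is a *process function* if for all $f_k:\mathcal X_k\to\mathcal A_k$ the map $\bm w\circ\bm f$, $\bm f=(f_k)_k$, has exactly one fixed point. An $n$-partite correlation $P(\bm o|\bm i)$ is *causal* if $P(\bm o|\bm i)=\sum_k q_k P_k(o_k|i_k)P_{k,i_k,o_k}(\bm o_{\backslash k}|\bm i_{\backslash k})$ with $q_k\ge 0$, $\sum_k q_k=1$, conditional distributions $P_k$ and (recursively) $(n-1)$-partite causal correlations $P_{k,i_k,o_k}$, the only $0$-partite one being $1$. A process function is *causal* if $P(\bm o|\bm i)=\sum_{\bm a,\bm x}\prod_k P_k(a_k,o_k|x_k,i_k)\,\delta_{\bm x,\bm w(\bm a)}$ is causal for all finite non-empty input sets, all finite output sets and all local stochastic channels $P_k(a_k,o_k|x_k,i_k)$; otherwise it is *non-causal*. Let $\bm w$ be a non-causal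 process function. For unitaries $U_k^{x}$ on $\mathbb C^{d_k}$ ($x\in\mathcal X_k$), put $|(a|x)\rangle_k=U_k^{x}|a\rangle$ and consider the condition (U) for all $k$ and all $(a,x)\ne(a',x')$ in $\mathcal A_k\times\mathcal X_k$: $\langle a'|(U_k^{x'})^\dagger U_k^{x}|a\rangle=0$ if and only if $x'=x$. Then unitaries with (U) exist, and for every choice of unitaries with (U) the product vectors $$\mathcal S=\Big\{\bigotimes_k U_k^{w_k(\bm a)}|a_k\rangle\ :\ \bm a\in\mathcal A\Big\}\subset\bigotimes_k\mathbb C^{d_k}$$ 1. form a complete product basis: they are $\prod_k d_k$ mutually orthogonal product vectors with normalised local factors; 2. are unambiguous: for every party $k$, two distinct local vectors $|(a_k|x_k)\rangle$, $|(a'_k|x'_k)\rangle$ that occur in $\mathcal S$ (so $x_k=w_k(\bm a)$, $x'_k=w_k(\bm a')$) are orthogonal if and only if $x_k=x'_k$, and, if $d_k\ge 2$, every local vector that occurs has a unique event label $(a_k|x_k)$; 3. are QNLWE: no LOCC protocol discriminates them perfectly. Here an LOCC protocol has any finite number of rounds; in each round one party, depending on all earlier announced outcomes, performs a local quantum instrument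 with finitely many outcomes (possibly changing the dimension of its system) and announces the outcome to all parties; at the end a state is guessed from the announced outcomes. -/

import Mathlib

open scoped BigOperators Matrix

noncomputable section

namespace ProcessQNLWE

/-! ### Process functions -/

/-- `w : 𝒜 → 𝒳` (with `𝒜 = ∏ₖ 𝒜ₖ`, `𝒳 = ∏ₖ 𝒳ₖ`) is a process function: for every choice of local
interventions `fₖ : 𝒳ₖ → 𝒜ₖ` the map `w ∘ f` has exactly one fixed point. -/
def IsProcessFunction {n : ℕ} {A X : Fin n → Type*} (w : (∀ k, A k) → ∀ k, X k) : Prop :=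
  ∀ f : ∀ k, X k → A k, ∃! x : ∀ k, X k, w (fun k => f k (x k)) = x

/-! ### Causal correlations and (non-)causal process functions -/

/-- `p b a` is a conditional probability distribution `P(a | b)` on the finite set `α`. -/
def IsCondDist {β α : Type*} [Fintype α] (p : β → α → ℝ) : Prop :=
  ∀ b, (∀ a, 0 ≤ p b a) ∧ ∑ a, p b a = 1

/-- `n`-partite causal correlations `P i o = P(o | i)`, defined recursively by
`P(o | i) = ∑ₖ qₖ Pₖ(oₖ | iₖ) P_{k,iₖ,oₖ}(o_{∖k} | i_{∖k})`, where `q` is a probability vector, each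
`Pₖ` is a single-party conditional distribution and each `P_{k,iₖ,oₖ}` is an `(n-1)`-partite causal
correlation.  For no party at all the only correlation is the constant `1`, so that for `n = 1` the
causal correlations are exactly the conditional distributions. -/
def IsCausalCorrelation : ∀ {n : ℕ} (I O : Fin n → Type) [∀ k, Fintype (O k)],
    ((∀ k, I k) → (∀ k, O k) → ℝ) → Prop
  | 0, _, _, _, P => ∀ i o, P i o = 1
  | n + 1, I, O, _, P =>
      ∃ (q : Fin (n + 1) → ℝ) (p : ∀ k, I k → O k → ℝ)
        (R : ∀ k, I k → O k → (∀ j : Fin n, I (k.succAbove j)) →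
          (∀ j : Fin n, O (k.succAbove j)) → ℝ),
        (∀ k, 0 ≤ q k) ∧ ∑ k, q k = 1 ∧
        (∀ k, IsCondDist (p k)) ∧
        (∀ k ik ok, IsCausalCorrelation (fun j => I (k.succAbove j)) (fun j => O (k.succAbove j))
          (R k ik ok)) ∧
        ∀ i o, P i o =
          ∑ k, q k * p k (i k) (o k) * R k (i k) (o k) (k.removeNth i) (k.removeNth o)

/-- The correlation `P(o | i) = ∑_{a,x} (∏ₖ Pₖ(aₖ, oₖ | xₖ, iₖ)) δ_{x, w(a)}` generated by `w` and the
local channels `M k (xₖ, iₖ) (aₖ, oₖ) = Pₖ(aₖ, oₖ | xₖ, iₖ)`. -/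
def correlation {n : ℕ} {A X : Fin n → Type*} [∀ k, Fintype (A k)] [∀ k, Fintype (X k)]
    [∀ k, DecidableEq (X k)] (w : (∀ k, A k) → ∀ k, X k) {I O : Fin n → Type}
    (M : ∀ k, X k × I k → A k × O k → ℝ) (i : ∀ k, I k) (o : ∀ k, O k) : ℝ :=
  ∑ a : ∀ k, A k, ∑ x : ∀ k, X k,
    (∏ k, M k (x k, i k) (a k, o k)) * (if x = w a then 1 else 0)

/-- A process function is causal if it generates causal correlations under all local operations,
for all finite sets of local inputs `I k` and outputs `O k` and all local stochastic channels. -/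
def IsCausalProcess {n : ℕ} {A X : Fin n → Type*} [∀ k, Fintype (A k)] [∀ k, Fintype (X k)]
    [∀ k, DecidableEq (X k)] (w : (∀ k, A k) → ∀ k, X k) : Prop :=
  ∀ (I O : Fin n → Type) [∀ k, Fintype (I k)] [∀ k, Nonempty (I k)] [∀ k, Fintype (O k)]
    (M : ∀ k, X k × I k → A k × O k → ℝ), (∀ k, IsCondDist (M k)) →
    IsCausalCorrelation I O (correlation w M)

/-! ### Product vectors and product bases -/

/-- The Hilbert space `⨂ₖ ℂ^{dₖ}`, in coordinates with respect to its computational basis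
`|a₁⟩ ⊗ ⋯ ⊗ |aₙ⟩`. -/
abbrev GlobalSpace {n : ℕ} (d : Fin n → ℕ) : Type := EuclideanSpace ℂ (∀ k, Fin (d k))

/-- The product vector `φ₁ ⊗ ⋯ ⊗ φₙ`. -/
def prodVec {n : ℕ} {d : Fin n → ℕ} (φ : ∀ k, EuclideanSpace ℂ (Fin (d k))) : GlobalSpace d :=
  WithLp.toLp 2 fun a => ∏ k, φ k (a k)

/-- The family of product vectors `ψʲ = ψʲ₁ ⊗ ⋯ ⊗ ψʲₙ` is a complete product basis: normalised local
vectors, mutually orthogonal product vectors, and `∏ₖ dₖ` of them. -/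
structure IsCompleteProductBasis {n : ℕ} {d : Fin n → ℕ} {J : Type*} [Fintype J]
    (ψ : J → ∀ k, EuclideanSpace ℂ (Fin (d k))) : Prop where
  local_norm : ∀ j k, ‖ψ j k‖ = 1
  orthonormal : Orthonormal ℂ fun j => prodVec (ψ j)
  card_eq : Fintype.card J = ∏ k, d k

/-- Unambiguity of the product vectors `ψʲ` with respect to the event labels `(aʲ | xʲ)` (outcomes and
settings): local vectors with the same label coincide, every local vector has only one label
(in a one-dimensional local space, which has only one ray, this is not asked), and two distinct
local vectors of a party are orthogonal if and only if they have the same setting. -/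
structure IsUnambiguous {n : ℕ} {d : Fin n → ℕ} {X : Fin n → Type*} {J : Type*}
    (ψ : J → ∀ k, EuclideanSpace ℂ (Fin (d k)))
    (a : J → ∀ k, Fin (d k)) (x : J → ∀ k, X k) : Prop where
  label_determines : ∀ k j j', a j k = a j' k → x j k = x j' k → ψ j k = ψ j' k
  label_unique : ∀ k, 2 ≤ d k → ∀ j j', ψ j k = ψ j' k → a j k = a j' k ∧ x j k = x j' k
  orthogonal_iff : ∀ k j j', ψ j k ≠ ψ j' k → (inner ℂ (ψ j' k) (ψ j k) = 0 ↔ x j' k = x j k)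

/-! ### Discrimination by local operations and classical communication -/

/-- The operator that acts as `K : ℂ^{d k} → ℂ^{d' k}` on the system of party `k` and as the identity
on the systems of all other parties (used when `d' l = d l` for all `l ≠ k`). -/
def liftOp {n : ℕ} {d d' : Fin n → ℕ} (k : Fin n) (K : Matrix (Fin (d' k)) (Fin (d k)) ℂ) :
    Matrix (∀ l, Fin (d' l)) (∀ l, Fin (d l)) ℂ :=
  Matrix.of fun b a => if ∀ l, l ≠ k → (b l : ℕ) = (a l : ℕ) then K (b k) (a k) else 0

/-- LOCC protocols with any finite number of rounds, for `n` parties holding systems of local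
dimensions `d k`, that end with a guess in `G`.  In a round some party `k` performs a local quantum
instrument whose outcome `s` is announced to everybody; outcome `s` has the Kraus operators
`K s r : ℂ^{d k} → ℂ^{d' k}`, so that party `k` can add or discard local systems and need not
announce all it learns.  Everything that follows, also who acts next, may depend on `s`. -/
inductive Protocol {n : ℕ} (G : Type*) : (Fin n → ℕ) → Type _
  | guess {d : Fin n → ℕ} (g : G) : Protocol G d
  | round {d : Fin n → ℕ} (k : Fin n) (d' : Fin n → ℕ) (hd : ∀ l, l ≠ k → d' l = d l)
      (N R : ℕ) (K : Fin N → Fin R → Matrix (Fin (d' k)) (Fin (d k)) ℂ)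
      (hK : ∑ s, ∑ r, (K s r)ᴴ * K s r = 1)
      (next : Fin N → Protocol G d') : Protocol G d

/-- The probability that the protocol, run on the pure state `ψ`, ends with the guess `g`
(for a vector `ψ` that is not normalised, the probability multiplied by `‖ψ‖²`). -/
def Protocol.prob {n : ℕ} {G : Type*} [DecidableEq G] : ∀ {d : Fin n → ℕ},
    Protocol G d → GlobalSpace d → G → ℝ
  | _, .guess g₀, ψ, g => if g = g₀ then ‖ψ‖ ^ 2 else 0
  | _, .round k _ _ _ _ K _ next, ψ, g =>
      ∑ s, ∑ r, (next s).prob (WithLp.toLp 2 (liftOp k (K s r) *ᵥ ψ.ofLp)) g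

/-- The product states `ψʲ` can be perfectly discriminated by an LOCC protocol. -/
def LOCCDiscriminable {n : ℕ} {d : Fin n → ℕ} {J : Type*} [DecidableEq J]
    (ψ : J → ∀ k, EuclideanSpace ℂ (Fin (d k))) : Prop :=
  ∃ P : Protocol J d, ∀ j, P.prob (prodVec (ψ j)) j = 1

/-- Quantum nonlocality without entanglement: mutually orthogonal product states that cannot be
perfectly discriminated by any LOCC protocol. -/
def IsQNLWE {n : ℕ} {d : Fin n → ℕ} {J : Type*} [DecidableEq J]
    (ψ : J → ∀ k, EuclideanSpace ℂ (Fin (d k))) : Prop :=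
  Orthonormal ℂ (fun j => prodVec (ψ j)) ∧ ¬ LOCCDiscriminable ψ

/-! ### The product basis of a process function -/

/-- The condition on the local unitaries `Uₖˣ`: the vectors `Uₖˣ|a⟩` and `Uₖˣ'|a'⟩` with different
labels `(a|x) ≠ (a'|x')` are orthogonal if and only if `x' = x`. -/
def UnambiguousUnitaries {n : ℕ} {d : Fin n → ℕ} {X : Fin n → Type*}
    (U : ∀ k, X k → Matrix.unitaryGroup (Fin (d k)) ℂ) : Prop :=
  ∀ (k : Fin n) (x x' : X k) (a a' : Fin (d k)), (a, x) ≠ (a', x') →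
    (((U k x' : Matrix (Fin (d k)) (Fin (d k)) ℂ)ᴴ *
      (U k x : Matrix (Fin (d k)) (Fin (d k)) ℂ)) a' a = 0 ↔ x' = x)

/-- The product vectors `⨂ₖ Uₖ^{wₖ(a)} |aₖ⟩`, indexed by `a ∈ 𝒜` and given by their local factors. -/
def encode {n : ℕ} {d : Fin n → ℕ} {X : Fin n → Type*} (w : (∀ k, Fin (d k)) → ∀ k, X k)
    (U : ∀ k, X k → Matrix.unitaryGroup (Fin (d k)) ℂ)
    (a : ∀ k, Fin (d k)) (k : Fin n) : EuclideanSpace ℂ (Fin (d k)) :=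
  WithLp.toLp 2 ((U k (w a k) : Matrix (Fin (d k)) (Fin (d k)) ℂ) *ᵥ Pi.single (a k) 1)

end ProcessQNLWE

end

open scoped BigOperators Matrix

noncomputable section

namespace ProcessQNLWE

/-! ### Sequential functions are causal -/

/-! Orthogonality is a restatement of the process property: for outputs `a ≠ b`, unique fixed points
force some party with `a k ≠ b k` to receive the same setting in both cases, and its two local
vectors then belong to one orthonormal basis (`IsProcessFunction.exists_ne_and_eq`).

For QNLWE, a sequential function generates only causal correlations, so `w` is not sequential.
Peeling off parties that receive constants therefore gets stuck: with the parties in some `S` fixed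
to `z`, every remaining party, and there is at least one, still receives at least two settings
(`exists_box_of_not_isSequential`). The box of all `a` agreeing with `z` on `S` already defeats
LOCC.

A protocol without errors must keep the box states orthogonal in every branch. Suppose a party `k ∉
S` acts. Box states differing only in `a k` have the same setting at `k`, and unambiguity makes
their other local overlaps nonzero, so the operator of `k` must preserve orthogonality of its basis.
This holds for two different settings. An operator `Mᴴ * M` diagonal in two bases with no zero
overlaps is scalar, so nothing is learned. A party in `S` holds a fixed vector and reveals nothing
either. Following a branch of nonzero weight to its guess leaves at least two nonzero candidates, a
contradiction (`Uninformative.not_neverErrs`). -/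

theorem exists_normalized {T : Type*} [Fintype T] [Nonempty T] (μ : T → ℝ) (hμ : ∀ t, 0 ≤ μ t) :
    ∃ ν : T → ℝ, (∀ t, 0 ≤ ν t) ∧ ∑ t, ν t = 1 ∧ ∀ t, μ t = (∑ s, μ s) * ν t := by
  classical
  by_cases h : ∑ s, μ s = 0
  · obtain ⟨t₀⟩ := ‹Nonempty T›
    refine ⟨Pi.single t₀ 1, fun t => ?_, by simp, fun t => ?_⟩
    · by_cases ht : t = t₀
      · subst ht; simp
      · simp [ht]
    · rw [h, zero_mul]
      exact (Finset.sum_eq_zero_iff_of_nonneg fun t _ => hμ t).1 h t (Finset.mem_univ t)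
  · refine ⟨fun t => μ t / ∑ s, μ s, fun t => div_nonneg (hμ t) (Finset.sum_nonneg fun s _ => hμ s),
      ?_, fun t => ?_⟩
    · rw [← Finset.sum_div, div_self h]
    · field_simp

theorem IsCondDist.mix {T β α : Type*} [Fintype T] [Fintype α] {ν : T → ℝ} (h0 : ∀ t, 0 ≤ ν t)
    (h1 : ∑ t, ν t = 1) {p : T → β → α → ℝ} (hp : ∀ t, IsCondDist (p t)) :
    IsCondDist fun b a => ∑ t, ν t * p t b a := by
  refine fun b => ⟨fun a => Finset.sum_nonneg fun t _ => mul_nonneg (h0 t) ((hp t b).1 a), ?_⟩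
  rw [Finset.sum_comm]
  simp_rw [← Finset.mul_sum, (hp _ b).2, mul_one, h1]

/-- Convex mixtures of causal correlations are causal. -/
theorem IsCausalCorrelation.mix {T : Type*} [Fintype T] : ∀ {n : ℕ} {I O : Fin n → Type}
    [∀ k, Fintype (O k)] (ν : T → ℝ) (_ : ∀ t, 0 ≤ ν t) (_ : ∑ t, ν t = 1)
    (P : T → (∀ k, I k) → (∀ k, O k) → ℝ) (_ : ∀ t, IsCausalCorrelation I O (P t)),
    IsCausalCorrelation I O fun i o => ∑ t, ν t * P t i o
  | 0, I, O, _, ν, h0, h1, P, hP => by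
      intro i o
      have h : ∀ t, P t i o = 1 := fun t => hP t i o
      simp [h, h1]
  | n + 1, I, O, _, ν, h0, h1, P, hP => by
      have hT : Nonempty T := by
        by_contra h
        rw [not_nonempty_iff] at h
        simp at h1
      choose q p R hq0 hq1 hp hR hPeq using hP
      -- Bayes: `κ k` is the posterior of `t` given that `k` acts first, `ρ k ik ok` the posterior
      -- after its input and output are also known. Where the total weight vanishes, any
      -- distribution serves.
      choose κ hκ0 hκ1 hκ using fun k => exists_normalized (fun t => ν t * q t k)
        fun t => mul_nonneg (h0 t) (hq0 t k)
      choose ρ hρ0 hρ1 hρ using fun k ik ok => exists_normalized (fun t => κ k t * p t k ik ok)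
        fun t => mul_nonneg (hκ0 k t) ((hp t k ik).1 ok)
      refine ⟨fun k => ∑ t, ν t * q t k, fun k ik ok => ∑ t, κ k t * p t k ik ok,
        fun k ik ok i o => ∑ t, ρ k ik ok t * R t k ik ok i o,
        fun k => Finset.sum_nonneg fun t _ => mul_nonneg (h0 t) (hq0 t k), ?_,
        fun k => IsCondDist.mix (hκ0 k) (hκ1 k) fun t => hp t k,
        fun k ik ok => IsCausalCorrelation.mix _ (hρ0 k ik ok) (hρ1 k ik ok) _
          fun t => hR t k ik ok, fun i o => ?_⟩
      · rw [Finset.sum_comm]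
        simp only [← Finset.mul_sum, hq1, mul_one, h1]
      · have e : ∀ t, P t i o = _ := fun t => hPeq t i o
        conv_lhs => simp only [e, Finset.mul_sum]
        rw [Finset.sum_comm]
        refine Finset.sum_congr rfl fun k _ => ?_
        beta_reduce
        rw [Finset.mul_sum]
        refine Finset.sum_congr rfl fun t _ => ?_
        have e1 := hκ k t
        have e2 := hρ k (i k) (o k) t
        calc _ = (ν t * q t k) * p t k (i k) (o k)
              * R t k (i k) (o k) (k.removeNth i) (k.removeNth o) := by ring
          _ = (∑ t, ν t * q t k) * (κ k t * p t k (i k) (o k))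
              * R t k (i k) (o k) (k.removeNth i) (k.removeNth o) := by rw [e1]; ring
          _ = _ := by rw [e2]; ring

/-- The function of the remaining parties when party `k` sends `c`. -/
def reduced {n : ℕ} {A X : Fin (n + 1) → Type*} (w : (∀ k, A k) → ∀ k, X k) (k : Fin (n + 1))
    (c : A k) (b : ∀ j, A (k.succAbove j)) (j : Fin n) : X (k.succAbove j) :=
  w (k.insertNth c b) (k.succAbove j)

/-- Some party receives a constant, and whatever it sends, the same holds recursively for the
function of the remaining parties. -/
def IsSequential : ∀ {n : ℕ} {A X : Fin n → Type*}, ((∀ k, A k) → ∀ k, X k) → Prop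
  | 0, _, _, _ => True
  | _ + 1, _, _, w => ∃ k, (∃ x, ∀ a, w a k = x) ∧ ∀ c, IsSequential (reduced w k c)

section correlation

variable {n : ℕ} {A X : Fin n → Type*} [∀ k, Fintype (A k)] [∀ k, Fintype (X k)]
  [∀ k, DecidableEq (X k)]

theorem correlation_eq (w : (∀ k, A k) → ∀ k, X k) {I O : Fin n → Type}
    (M : ∀ k, X k × I k → A k × O k → ℝ) (i : ∀ k, I k) (o : ∀ k, O k) :
    correlation w M i o = ∑ a : ∀ k, A k, ∏ k, M k (w a k, i k) (a k, o k) := by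
  unfold correlation
  refine Finset.sum_congr rfl fun a _ => ?_
  simp

end correlation

theorem correlation_eq_sum_reduced {n : ℕ} {A X : Fin (n + 1) → Type*} [∀ k, Fintype (A k)]
    [∀ k, Fintype (X k)] [∀ k, DecidableEq (X k)] (w : (∀ k, A k) → ∀ k, X k)
    {I O : Fin (n + 1) → Type} (M : ∀ k, X k × I k → A k × O k → ℝ) (k : Fin (n + 1)) (x : X k)
    (hx : ∀ a, w a k = x) (i : ∀ k, I k) (o : ∀ k, O k) :
    correlation w M i o = ∑ c, M k (x, i k) (c, o k) *
      correlation (reduced w k c) (fun j => M (k.succAbove j)) (k.removeNth i) (k.removeNth o) := by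
  simp_rw [correlation_eq]
  rw [← (Fin.insertNthEquiv A k).sum_comp, Fintype.sum_prod_type]
  refine Finset.sum_congr rfl fun c _ => ?_
  rw [Finset.mul_sum]
  refine Finset.sum_congr rfl fun b _ => ?_
  rw [Fin.prod_univ_succAbove _ k]
  simp [hx, reduced, Fin.removeNth, Fin.insertNthEquiv]

/-- The definition of causality asks for correlations of the remaining parties even for a first
party of weight zero; this fills those slots. The distributions `p` are needed because an output set
could be empty. -/
theorem exists_isCausalCorrelation : ∀ {n : ℕ} (I O : Fin n → Type) [∀ k, Fintype (O k)]
    (p : ∀ k, I k → O k → ℝ) (_ : ∀ k, IsCondDist (p k)), ∃ P, IsCausalCorrelation I O P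
  | 0, _, _, _, _, _ => ⟨fun _ _ => 1, fun _ _ => rfl⟩
  | n + 1, I, O, _, p, hp => by
      choose Q hQ using fun k : Fin (n + 1) => exists_isCausalCorrelation
        (fun j => I (k.succAbove j)) (fun j => O (k.succAbove j)) (fun j => p (k.succAbove j))
        fun j => hp _
      refine ⟨_, Pi.single 0 1, p, fun k _ _ => Q k, fun k => ?_, by simp, hp, fun k _ _ => hQ k,
        fun i o => rfl⟩
      by_cases h : k = 0
      · subst h; simp
      · simp [h]

/-- The party with constant setting acts first. What it sent is hidden behind its input and output,
so the others see a mixture, with posterior weights `ρ`, of the correlations of `reduced w k c`. -/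
theorem IsSequential.isCausalCorrelation : ∀ {n : ℕ} {A X : Fin n → Type*} [∀ k, Fintype (A k)]
    [∀ k, Nonempty (A k)] [∀ k, Fintype (X k)] [∀ k, DecidableEq (X k)]
    {w : (∀ k, A k) → ∀ k, X k} (_ : IsSequential w) (I O : Fin n → Type) [∀ k, Fintype (O k)]
    (M : ∀ k, X k × I k → A k × O k → ℝ) (_ : ∀ k, IsCondDist (M k)),
    IsCausalCorrelation I O (correlation w M)
  | 0, A, X, _, _, _, _, w, _, I, O, _, M, hM => by
      intro i o
      rw [correlation_eq]
      simp
  | n + 1, A, X, _, _, _, _, w, ⟨k, ⟨x, hx⟩, hw⟩, I, O, _, M, hM => by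
      classical
      have x₀ : ∀ j, X j := w fun j => Classical.arbitrary _
      have hC : ∀ c, IsCausalCorrelation (fun j => I (k.succAbove j)) (fun j => O (k.succAbove j))
          (correlation (reduced w k c) fun j => M (k.succAbove j)) := fun c =>
        (hw c).isCausalCorrelation _ _ _ fun j => hM _
      have hp : ∀ j (y : X j), IsCondDist fun (b : I j) (o : O j) => ∑ c, M j (y, b) (c, o) :=
        fun j y b => ⟨fun o => Finset.sum_nonneg fun c _ => (hM j _).1 _, by
          rw [Finset.sum_comm, ← Fintype.sum_prod_type']
          exact (hM j (y, b)).2⟩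
      choose ρ hρ0 hρ1 hρ using fun ik ok => exists_normalized (fun c => M k (x, ik) (c, ok))
        fun c => (hM k _).1 _
      choose Q hQ using fun j : Fin (n + 1) => exists_isCausalCorrelation
        (fun l => I (j.succAbove l)) (fun l => O (j.succAbove l)) _ fun l => hp _ (x₀ _)
      let y : ∀ j, X j := Function.update x₀ k x
      let R : ∀ j, I j → O j → (∀ l, I (j.succAbove l)) → (∀ l, O (j.succAbove l)) → ℝ :=
        Function.update (fun j _ _ => Q j) k fun ik ok i o => ∑ c, ρ ik ok c *
          correlation (reduced w k c) (fun j => M (k.succAbove j)) i o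
      refine ⟨Pi.single k 1, fun j b o => ∑ c, M j (y j, b) (c, o), R, fun j => ?_, by simp,
        fun j => hp j _, fun j ij oj => ?_, fun i o => ?_⟩
      · by_cases h : j = k
        · subst h; simp
        · simp [h]
      · by_cases h : j = k
        · subst h
          simp only [R, Function.update_self]
          exact IsCausalCorrelation.mix _ (hρ0 ij oj) (hρ1 ij oj) _ hC
        · simp only [R, Function.update_of_ne h]
          exact hQ j
      · rw [correlation_eq_sum_reduced w M k x hx, Finset.sum_eq_single k]
        · simp only [Pi.single_eq_same, one_mul, R, y, Function.update_self, Finset.mul_sum]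
          refine Finset.sum_congr rfl fun c _ => ?_
          rw [hρ, mul_assoc]
        · intro j _ hj
          simp [hj]
        · simp

/-! ### A non-sequential part of a function that is not sequential -/

/-- If `w` is not sequential, then some parties `S` can fix what they send so that these parties
receive constants while every other party does not. -/
theorem exists_box_of_not_isSequential : ∀ {n : ℕ} {A X : Fin n → Type*} [∀ k, Nonempty (A k)]
    {w : (∀ k, A k) → ∀ k, X k} (_ : ¬ IsSequential w),
    ∃ (S : Set (Fin n)) (z : ∀ k, A k), (∃ k, k ∉ S) ∧
      (∀ k ∈ S, ∀ a, (∀ l ∈ S, a l = z l) → w a k = w z k) ∧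
      ∀ k ∉ S, ∃ a, (∀ l ∈ S, a l = z l) ∧ w a k ≠ w z k
  | 0, _, _, _, _, hw => (hw trivial).elim
  | n + 1, A, X, _, w, hw => by
      by_cases h : ∃ k x, ∀ a, w a k = x
      -- Party `k` joins `S` and sends a value `c` for which the rest is still not sequential.
      · obtain ⟨k, x, hx⟩ := h
        obtain ⟨c, hc⟩ : ∃ c, ¬ IsSequential (reduced w k c) := by
          by_contra! hc
          exact hw ⟨k, ⟨x, hx⟩, hc⟩
        obtain ⟨S, z, ⟨j, hj⟩, hS, hS'⟩ := exists_box_of_not_isSequential hc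
        refine ⟨insert k (k.succAbove '' S), k.insertNth c z, ⟨k.succAbove j, ?_⟩, ?_, ?_⟩
        · simpa [Fin.succAbove_ne] using hj
        · intro l hl a ha
          obtain rfl | ⟨l, hl, rfl⟩ := hl
          · rw [hx, hx]
          · have ha' : a = k.insertNth c (k.removeNth a) := by
              have := ha k (Set.mem_insert _ _)
              rw [Fin.insertNth_apply_same] at this
              rw [← this, Fin.insertNth_self_removeNth]
            rw [ha']
            refine hS l hl (k.removeNth a) fun m hm => ?_
            simpa [Fin.removeNth] using
              ha (k.succAbove m) (Set.mem_insert_of_mem _ (Set.mem_image_of_mem _ hm))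
        · intro l hl
          obtain rfl | ⟨l, rfl⟩ := Fin.eq_self_or_eq_succAbove k l
          · exact (hl (Set.mem_insert _ _)).elim
          · obtain ⟨a, ha, hne⟩ := hS' l fun h =>
              hl (Set.mem_insert_of_mem _ (Set.mem_image_of_mem _ h))
            refine ⟨k.insertNth c a, fun m hm => ?_, hne⟩
            obtain rfl | ⟨m, hm, rfl⟩ := hm
            · simp
            · simpa using ha m hm
      -- No party receives a constant, so `S = ∅` works with any `z`.
      · push Not at h
        have z : ∀ k, A k := fun k => Classical.arbitrary _
        refine ⟨∅, z, ⟨0, by simp⟩, by simp, fun k _ => ?_⟩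
        obtain ⟨a, ha⟩ := h k (w z k)
        exact ⟨a, by simp, ha⟩

/-! ### Process functions -/

section processFunction

variable {n : ℕ} {A X : Fin n → Type*} {w : (∀ k, A k) → ∀ k, X k}

/-- Two different outputs are told apart by some party that receives the same in both cases. -/
theorem IsProcessFunction.exists_ne_and_eq (hw : IsProcessFunction w) {a b : ∀ k, A k}
    (hab : a ≠ b) : ∃ k, a k ≠ b k ∧ w a k = w b k := by
  classical
  by_contra! h
  -- If the claim fails, these interventions turn both `w a` and `w b` into fixed points.
  have key := hw fun k x => if x = w a k then a k else b k
  have h1 : (fun k => if w a k = w a k then a k else b k) = a := by simp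
  have h2 : (fun k => if w b k = w a k then a k else b k) = b := by
    funext k
    by_cases hk : a k = b k
    · simp [hk]
    · rw [if_neg fun e => h k hk e.symm]
  have hwab : w a = w b := key.unique (congrArg w h1) (congrArg w h2)
  obtain ⟨k, hk⟩ := Function.ne_iff.1 hab
  exact h k hk (congrFun hwab k)

/-- No party signals to itself: outputs differing only at `k` can be told apart only by `k`. -/
theorem IsProcessFunction.apply_update (hw : IsProcessFunction w) (a : ∀ k, A k) (k : Fin n)
    (c : A k) : w (Function.update a k c) k = w a k := by
  by_cases hc : a = Function.update a k c
  · rw [← hc]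
  · obtain ⟨l, hl, hl'⟩ := hw.exists_ne_and_eq hc
    obtain rfl : l = k := by
      by_contra hlk
      exact hl (Function.update_of_ne hlk _ _).symm
    exact hl'.symm

end processFunction

/-! ### Local unitaries -/

/-- The matrix `1 + (u - 1) P` with `P` the projection onto the uniform superposition. -/
def phaseMatrix (d : ℕ) (u : ℂ) : Matrix (Fin d) (Fin d) ℂ :=
  1 + Matrix.of fun _ _ => (u - 1) / d

theorem phaseMatrix_conjTranspose (d : ℕ) (u : ℂ) :
    (phaseMatrix d u)ᴴ = phaseMatrix d (star u) := by
  ext i j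
  simp [phaseMatrix, Matrix.one_apply, eq_comm]

theorem phaseMatrix_mul {d : ℕ} (hd : 1 ≤ d) (u v : ℂ) :
    phaseMatrix d u * phaseMatrix d v = phaseMatrix d (u * v) := by
  have hd' : (d : ℂ) ≠ 0 := by exact_mod_cast (by omega : d ≠ 0)
  simp only [phaseMatrix, add_mul, mul_add, one_mul, mul_one]
  ext i j
  simp only [Matrix.add_apply, Matrix.of_apply, Matrix.mul_apply, Finset.sum_const, Finset.card_univ, Fintype.card_fin, nsmul_eq_mul]
  field_simp
  ring

theorem phaseMatrix_one (d : ℕ) : phaseMatrix d 1 = 1 := by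
  ext i j
  simp [phaseMatrix]

/-- Off-diagonal entries vanish only for `u = 1`, diagonal ones only for `u = 1 - d`, which for `d ≥
1` has modulus one only if `d = 2` and `u = -1`. -/
theorem phaseMatrix_apply_ne_zero {d : ℕ} (hd : 1 ≤ d) {u : ℂ} (hu : ‖u‖ = 1) (h1 : u ≠ 1)
    (h1' : u ≠ -1) (i j : Fin d) : phaseMatrix d u i j ≠ 0 := by
  have hd' : (d : ℂ) ≠ 0 := by exact_mod_cast (by omega : d ≠ 0)
  intro h
  by_cases hij : i = j
  · simp only [phaseMatrix, Matrix.add_apply, Matrix.one_apply, hij, if_true,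
      Matrix.of_apply] at h
    have hu' : u = ((1 - d : ℝ) : ℂ) := by
      field_simp at h
      push_cast
      linear_combination h
    rw [hu', Complex.norm_real, Real.norm_eq_abs] at hu
    have hd2 : d = 2 := by
      rcases abs_eq (zero_le_one' ℝ) |>.1 hu with h | h
      · have : (d : ℝ) = 0 := by linarith
        have : d = 0 := by exact_mod_cast this
        omega
      · have : (d : ℝ) = 2 := by linarith
        exact_mod_cast this
    apply h1'
    rw [hu', hd2]
    norm_num
  · simp only [phaseMatrix, Matrix.add_apply, Matrix.one_apply, hij, if_false, zero_add,
      Matrix.of_apply, div_eq_zero_iff, hd', or_false] at h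
    exact h1 (sub_eq_zero.1 h)

/-- The Cayley transform of `i t`. -/
def cayleyPhase (t : ℕ) : ℂ := (1 + t * Complex.I) / (1 - t * Complex.I)

theorem one_add_mul_I_ne_zero (t : ℝ) : (1 + t * Complex.I : ℂ) ≠ 0 := by
  intro h
  simpa using congrArg Complex.re h

theorem one_sub_mul_I_ne_zero (t : ℝ) : (1 - t * Complex.I : ℂ) ≠ 0 := by
  intro h
  simpa using congrArg Complex.re h

theorem star_cayleyPhase (t : ℕ) :
    star (cayleyPhase t) = (1 - t * Complex.I) / (1 + t * Complex.I) := by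
  simp [cayleyPhase, sub_eq_add_neg]

theorem star_cayleyPhase_mul_self (t : ℕ) : star (cayleyPhase t) * cayleyPhase t = 1 := by
  have h1 := one_add_mul_I_ne_zero t
  have h2 := one_sub_mul_I_ne_zero t
  push_cast at h1 h2
  rw [star_cayleyPhase, cayleyPhase]
  field_simp

theorem norm_cayleyPhase (t : ℕ) : ‖cayleyPhase t‖ = 1 := by
  have h := congrArg norm (star_cayleyPhase_mul_self t)
  rw [norm_mul, norm_star, norm_one] at h
  nlinarith [norm_nonneg (cayleyPhase t)]

/-- Relative phase `1` would force `s = t`, and `-1` would force `s * t = -1`. -/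
theorem star_cayleyPhase_mul_ne {s t : ℕ} (hst : s ≠ t) :
    star (cayleyPhase s) * cayleyPhase t ≠ 1 ∧ star (cayleyPhase s) * cayleyPhase t ≠ -1 := by
  have h1 := one_add_mul_I_ne_zero s
  have h2 := one_sub_mul_I_ne_zero t
  push_cast at h1 h2
  rw [star_cayleyPhase, cayleyPhase, div_mul_div_comm]
  constructor <;> intro h <;> rw [div_eq_iff (mul_ne_zero h1 h2)] at h
  · have := congrArg Complex.im h
    simp at this
    apply hst
    have h3 : (s : ℝ) = t := by linarith
    exact_mod_cast h3
  · have := congrArg Complex.re h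
    simp at this
    have h3 : (0 : ℝ) ≤ s * t := by positivity
    linarith

theorem exists_unambiguousUnitaries {n : ℕ} (d : Fin n → ℕ) (hd : ∀ k, 1 ≤ d k)
    (X : Fin n → Type*) [∀ k, Fintype (X k)] :
    ∃ U : ∀ k, X k → Matrix.unitaryGroup (Fin (d k)) ℂ, UnambiguousUnitaries U := by
  have hmem : ∀ k t, phaseMatrix (d k) (cayleyPhase t) ∈ Matrix.unitaryGroup (Fin (d k)) ℂ := by
    intro k t
    rw [Matrix.mem_unitaryGroup_iff', Matrix.star_eq_conjTranspose, phaseMatrix_conjTranspose,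
      phaseMatrix_mul (hd k), star_cayleyPhase_mul_self, phaseMatrix_one]
  refine ⟨fun k x => ⟨_, hmem k (Fintype.equivFin (X k) x)⟩, fun k x x' a a' hne => ?_⟩
  simp only [phaseMatrix_conjTranspose, phaseMatrix_mul (hd k)]
  constructor
  · intro h
    by_contra hx
    have hst : (Fintype.equivFin (X k) x' : ℕ) ≠ Fintype.equivFin (X k) x := by
      intro e
      exact hx ((Fintype.equivFin (X k)).injective (Fin.ext e))
    obtain ⟨h1, h1'⟩ := star_cayleyPhase_mul_ne hst
    exact phaseMatrix_apply_ne_zero (hd k)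
      (by rw [norm_mul, norm_star, norm_cayleyPhase, norm_cayleyPhase, one_mul]) h1 h1' _ _ h
  · rintro rfl
    rw [star_cayleyPhase_mul_self, phaseMatrix_one]
    exact Matrix.one_apply_ne fun e => hne (by rw [e])

/-! ### The product basis -/

section basis

variable {n : ℕ} {d : Fin n → ℕ}

theorem inner_prodVec (φ χ : ∀ k, EuclideanSpace ℂ (Fin (d k))) :
    inner ℂ (prodVec φ) (prodVec χ) = ∏ k, inner ℂ (φ k) (χ k) := by
  simp only [prodVec, PiLp.inner_apply, Finset.prod_univ_sum, Fintype.piFinset_univ]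
  refine Finset.sum_congr rfl fun a _ => ?_
  simp [Finset.prod_mul_distrib]

variable {X : Fin n → Type*} {w : (∀ k, Fin (d k)) → ∀ k, X k}
  {U : ∀ k, X k → Matrix.unitaryGroup (Fin (d k)) ℂ}

theorem inner_mulVec_single {m p : ℕ} (V W : Matrix (Fin m) (Fin p) ℂ) (i j : Fin p) :
    inner ℂ (WithLp.toLp 2 (V *ᵥ Pi.single i 1)) (WithLp.toLp 2 (W *ᵥ Pi.single j 1)) =
      (Vᴴ * W) i j := by
  simp [PiLp.inner_apply, Matrix.mul_apply, mul_comm]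

theorem inner_encode (a b : ∀ k, Fin (d k)) (k : Fin n) :
    inner ℂ (encode w U a k) (encode w U b k) =
      ((U k (w a k) : Matrix (Fin (d k)) (Fin (d k)) ℂ)ᴴ *
        (U k (w b k) : Matrix (Fin (d k)) (Fin (d k)) ℂ)) (a k) (b k) :=
  inner_mulVec_single _ _ _ _

theorem conjTranspose_mul_self_coe {m : ℕ} (V : Matrix.unitaryGroup (Fin m) ℂ) :
    (V : Matrix (Fin m) (Fin m) ℂ)ᴴ * (V : Matrix (Fin m) (Fin m) ℂ) = 1 :=
  Matrix.mem_unitaryGroup_iff'.1 V.2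

theorem inner_encode_of_eq {a b : ∀ k, Fin (d k)} {k : Fin n} (h : w a k = w b k) :
    inner ℂ (encode w U a k) (encode w U b k) = if a k = b k then (1 : ℂ) else 0 := by
  rw [inner_encode, h, conjTranspose_mul_self_coe, Matrix.one_apply]

theorem norm_eq_one_of_inner_self {E : Type*} [NormedAddCommGroup E] [InnerProductSpace ℂ E] {v : E}
    (h : inner ℂ v v = (1 : ℂ)) : ‖v‖ = 1 := by
  have e := inner_self_eq_norm_sq (𝕜 := ℂ) v
  rw [h] at e
  exact (pow_eq_one_iff_of_nonneg (norm_nonneg _) two_ne_zero).1 (by simpa using e.symm)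

theorem norm_encode (a : ∀ k, Fin (d k)) (k : Fin n) : ‖encode w U a k‖ = 1 :=
  norm_eq_one_of_inner_self ((inner_encode_of_eq rfl).trans (if_pos rfl))

theorem norm_prodVec (φ : ∀ k, EuclideanSpace ℂ (Fin (d k))) (h : ∀ k, ‖φ k‖ = 1) :
    ‖prodVec φ‖ = 1 := by
  refine norm_eq_one_of_inner_self ?_
  rw [inner_prodVec]
  simp [inner_self_eq_norm_sq_to_K, h]

theorem IsProcessFunction.isCompleteProductBasis (hw : IsProcessFunction w) :
    IsCompleteProductBasis (encode w U) where
  local_norm := norm_encode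
  orthonormal := by
    refine ⟨fun a => norm_prodVec _ (norm_encode a), fun a b hab => ?_⟩
    obtain ⟨k, hk, hk'⟩ := hw.exists_ne_and_eq hab
    simp only [inner_prodVec]
    refine Finset.prod_eq_zero (Finset.mem_univ k) ?_
    rw [inner_encode_of_eq hk', if_neg hk]
  card_eq := by simp

theorem encode_congr {a b : ∀ k, Fin (d k)} {k : Fin n} (ha : a k = b k) (hx : w a k = w b k) :
    encode w U a k = encode w U b k := by
  simp only [encode, ha, hx]

theorem UnambiguousUnitaries.isUnambiguous (hU : UnambiguousUnitaries U) :
    IsUnambiguous (encode w U) (fun a => a) w where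
  label_determines k a b ha hx := encode_congr ha hx
  label_unique k hk a b hab := by
    have hne : inner ℂ (encode w U b k) (encode w U a k) ≠ 0 := by
      rw [hab, inner_self_eq_norm_sq_to_K, norm_encode]
      simp
    by_contra hlab
    rw [inner_encode] at hne
    have hlab' : (a k, w a k) ≠ (b k, w b k) := by simpa using hlab
    have hx : w b k ≠ w a k := fun e => hne ((hU k _ _ _ _ hlab').2 e)
    -- Here `2 ≤ d k` enters: a second vector of the basis with setting `w a k` is orthogonal to the
    -- shared local vector, contradicting the different setting `w b k`.
    obtain ⟨c, hc⟩ : ∃ c : Fin (d k), c ≠ a k := by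
      have := Fin.nontrivial_iff_two_le.2 hk
      exact exists_ne _
    refine hx ((hU k (w a k) (w b k) c (b k) fun e => hx (congrArg Prod.snd e).symm).1 ?_)
    have h0 : inner ℂ (encode w U a k) (WithLp.toLp 2
        ((U k (w a k) : Matrix (Fin (d k)) (Fin (d k)) ℂ) *ᵥ Pi.single c 1)) = (0 : ℂ) := by
      rw [encode, inner_mulVec_single, conjTranspose_mul_self_coe, Matrix.one_apply_ne hc.symm]
    rw [hab, encode, inner_mulVec_single] at h0
    exact h0
  orthogonal_iff k a b hab := by
    rw [inner_encode]
    refine hU k _ _ _ _ fun e => hab ?_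
    simp only [Prod.mk.injEq] at e
    exact encode_congr e.1 e.2

end basis

/-! ### Local operations -/

section localOperations

variable {n : ℕ}

/-- The local operators of the round in which party `k` applies `K`. -/
def roundOp {d d' : Fin n → ℕ} (k : Fin n) (K : Matrix (Fin (d' k)) (Fin (d k)) ℂ) (l : Fin n) :
    Matrix (Fin (d' l)) (Fin (d l)) ℂ :=
  Function.update (β := fun l => Matrix (Fin (d' l)) (Fin (d l)) ℂ)
    (fun l => Matrix.of fun (i : Fin (d' l)) (j : Fin (d l)) => if (i : ℕ) = j then 1 else 0) k K l

theorem roundOp_self {d d' : Fin n → ℕ} (k : Fin n) (K : Matrix (Fin (d' k)) (Fin (d k)) ℂ) :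
    roundOp k K k = K :=
  Function.update_self _ _ _

theorem roundOp_of_ne {d d' : Fin n → ℕ} {k l : Fin n} (h : l ≠ k)
    (K : Matrix (Fin (d' k)) (Fin (d k)) ℂ) :
    roundOp k K l =
      Matrix.of fun (i : Fin (d' l)) (j : Fin (d l)) => if (i : ℕ) = j then 1 else 0 :=
  Function.update_of_ne h _ _

theorem conjTranspose_roundOp_mul_roundOp {d d' : Fin n → ℕ} {k l : Fin n} (h : l ≠ k)
    (hd : d' l = d l) (K K' : Matrix (Fin (d' k)) (Fin (d k)) ℂ) :
    (roundOp k K l)ᴴ * roundOp k K' l = 1 := by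
  rw [roundOp_of_ne h, roundOp_of_ne h]
  ext i j
  rw [Matrix.mul_apply, Finset.sum_eq_single (Fin.cast hd.symm i)]
  · simp [Matrix.one_apply, Fin.ext_iff]
  · intro b _ hb
    have : (b : ℕ) ≠ i := fun e => hb (Fin.ext e)
    simp [this]
  · simp

/-- The tensor factorisation reduces global statements to single parties. Idle factors compare
underlying naturals because `d' l = d l` is only a propositional equality. -/
theorem liftOp_apply {d d' : Fin n → ℕ} (k : Fin n) (K : Matrix (Fin (d' k)) (Fin (d k)) ℂ)
    (b : ∀ l, Fin (d' l)) (a : ∀ l, Fin (d l)) :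
    liftOp k K b a = ∏ l, roundOp k K l (b l) (a l) := by
  rw [← Finset.mul_prod_erase _ _ (Finset.mem_univ k), roundOp_self]
  have h : ∏ l ∈ Finset.univ.erase k, roundOp k K l (b l) (a l) =
      ∏ l ∈ Finset.univ.erase k, if (b l : ℕ) = a l then (1 : ℂ) else 0 :=
    Finset.prod_congr rfl fun l hl => by rw [roundOp_of_ne (Finset.ne_of_mem_erase hl)]; rfl
  rw [h, Finset.prod_ite_zero]
  simp [liftOp]

theorem liftOp_mulVec_prodVec {d d' : Fin n → ℕ} (k : Fin n)
    (K : Matrix (Fin (d' k)) (Fin (d k)) ℂ) (φ : ∀ l, EuclideanSpace ℂ (Fin (d l))) :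
    WithLp.toLp 2 (liftOp k K *ᵥ (prodVec φ).ofLp) =
      prodVec fun l => WithLp.toLp 2 (roundOp k K l *ᵥ (φ l).ofLp) := by
  ext b
  simp only [prodVec, Matrix.mulVec, dotProduct, liftOp_apply, ← Finset.prod_mul_distrib,
    Finset.prod_univ_sum, Fintype.piFinset_univ]

theorem conjTranspose_liftOp_mul_liftOp {d d' : Fin n → ℕ} (k : Fin n)
    (hd : ∀ l, l ≠ k → d' l = d l) (K : Matrix (Fin (d' k)) (Fin (d k)) ℂ) :
    (liftOp k K)ᴴ * liftOp k K = liftOp k (Kᴴ * K) := by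
  ext a b
  rw [liftOp_apply, Matrix.mul_apply]
  simp only [Matrix.conjTranspose_apply, liftOp_apply, star_prod, ← Finset.prod_mul_distrib]
  have h : ∀ l, roundOp k (Kᴴ * K) l = (roundOp k K l)ᴴ * roundOp k K l := by
    intro l
    by_cases hl : l = k
    · subst hl
      simp only [roundOp_self]
    · rw [conjTranspose_roundOp_mul_roundOp hl (hd l hl), roundOp_of_ne hl]
      ext i j
      simp [Matrix.one_apply, Fin.ext_iff]
  simp only [h, Matrix.mul_apply, Matrix.conjTranspose_apply, Finset.prod_univ_sum,
    Fintype.piFinset_univ]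

theorem liftOp_sum {ι : Type*} {d d' : Fin n → ℕ} (k : Fin n) (s : Finset ι)
    (K : ι → Matrix (Fin (d' k)) (Fin (d k)) ℂ) :
    liftOp k (∑ i ∈ s, K i) = ∑ i ∈ s, liftOp k (K i) := by
  ext b a
  simp only [liftOp, Matrix.of_apply, Matrix.sum_apply]
  split_ifs <;> simp

theorem liftOp_one {d : Fin n → ℕ} (k : Fin n) :
    liftOp k (1 : Matrix (Fin (d k)) (Fin (d k)) ℂ) = 1 := by
  ext b a
  simp only [liftOp, Matrix.of_apply, Matrix.one_apply]
  by_cases h : b = a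
  · subst h; simp
  · rw [if_neg h]
    split_ifs with h1 h2
    · refine (h (funext fun l => ?_)).elim
      by_cases hl : l = k
      · subst hl; exact h2
      · exact Fin.ext (h1 l hl)
    all_goals rfl

/-- A complete local instrument preserves inner products of global states, summed over its
outcomes. -/
theorem sum_inner_liftOp {d d' : Fin n → ℕ} (k : Fin n) (hd : ∀ l, l ≠ k → d' l = d l) {N R : ℕ}
    {K : Fin N → Fin R → Matrix (Fin (d' k)) (Fin (d k)) ℂ}
    (hK : ∑ s, ∑ r, (K s r)ᴴ * K s r = 1) (φ χ : GlobalSpace d) :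
    ∑ s, ∑ r, inner ℂ (WithLp.toLp 2 (liftOp k (K s r) *ᵥ φ.ofLp) : GlobalSpace d')
      (WithLp.toLp 2 (liftOp k (K s r) *ᵥ χ.ofLp)) = (inner ℂ φ χ : ℂ) := by
  have h : ∑ s, ∑ r, (liftOp k (K s r))ᴴ * liftOp k (K s r) = 1 := by
    simp only [conjTranspose_liftOp_mul_liftOp k hd, ← liftOp_sum, hK, liftOp_one]
  have e : ∀ s r, inner ℂ (WithLp.toLp 2 (liftOp k (K s r) *ᵥ φ.ofLp) : GlobalSpace d')
      (WithLp.toLp 2 (liftOp k (K s r) *ᵥ χ.ofLp)) =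
      star φ.ofLp ⬝ᵥ (((liftOp k (K s r))ᴴ * liftOp k (K s r)) *ᵥ χ.ofLp) := by
    intro s r
    rw [EuclideanSpace.inner_toLp_toLp, dotProduct_comm, Matrix.star_mulVec,
      ← Matrix.dotProduct_mulVec, Matrix.mulVec_mulVec]
  simp only [e, ← dotProduct_sum, ← Matrix.sum_mulVec, h, Matrix.one_mulVec]
  rw [dotProduct_comm, ← EuclideanSpace.inner_toLp_toLp]

end localOperations

/-! ### Perfect discrimination -/

section discrimination

variable {n : ℕ} {G : Type*} [DecidableEq G]

theorem Protocol.prob_nonneg : ∀ {d : Fin n → ℕ} (P : Protocol G d) (ψ : GlobalSpace d) (g : G),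
    0 ≤ P.prob ψ g
  | _, .guess g₀, ψ, g => by
      rw [Protocol.prob]
      split_ifs <;> positivity
  | _, .round k _ _ _ _ K _ next, ψ, g => by
      rw [Protocol.prob]
      exact Finset.sum_nonneg fun s _ => Finset.sum_nonneg fun r _ => (next s).prob_nonneg _ _

theorem Protocol.sum_prob [Fintype G] : ∀ {d : Fin n → ℕ} (P : Protocol G d) (ψ : GlobalSpace d),
    ∑ g, P.prob ψ g = ‖ψ‖ ^ 2
  | _, .guess g₀, ψ => by simp [Protocol.prob]
  | _, .round k _ hd _ _ K hK next, ψ => by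
      simp only [Protocol.prob]
      rw [Finset.sum_comm]
      have h := congrArg Complex.re (sum_inner_liftOp k hd hK ψ ψ)
      simp only [Complex.re_sum] at h
      have e : ∀ {d : Fin n → ℕ} (φ : GlobalSpace d), (inner ℂ φ φ : ℂ).re = ‖φ‖ ^ 2 :=
        fun φ => inner_self_eq_norm_sq (𝕜 := ℂ) φ
      rw [e] at h
      rw [← h]
      refine Finset.sum_congr rfl fun s _ => ?_
      rw [Finset.sum_comm]
      refine Finset.sum_congr rfl fun r _ => ?_
      rw [(next s).sum_prob, e]

/-- A protocol that never mistakes the states it is run on for anything else. -/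
def Protocol.NeverErrs {d : Fin n → ℕ} (P : Protocol G d) (B : Set G) (φ : G → GlobalSpace d) :
    Prop :=
  ∀ j ∈ B, ∀ g, g ≠ j → P.prob (φ j) g = 0

/-- An error probability is a sum of nonnegative terms over all Kraus branches, so it vanishes in
each, including those told apart only by the unannounced `r`. -/
theorem Protocol.NeverErrs.next {d d' : Fin n → ℕ} {k : Fin n} {hd : ∀ l, l ≠ k → d' l = d l}
    {N R : ℕ} {K : Fin N → Fin R → Matrix (Fin (d' k)) (Fin (d k)) ℂ}
    {hK : ∑ s, ∑ r, (K s r)ᴴ * K s r = 1} {next : Fin N → Protocol G d'} {B : Set G}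
    {φ : G → GlobalSpace d} (h : (Protocol.round k d' hd N R K hK next).NeverErrs B φ)
    (s : Fin N) (r : Fin R) :
    (next s).NeverErrs B fun j => WithLp.toLp 2 (liftOp k (K s r) *ᵥ (φ j).ofLp) := by
  intro j hj g hg
  have h0 := h j hj g hg
  rw [Protocol.prob, Finset.sum_eq_zero_iff_of_nonneg fun s _ => Finset.sum_nonneg fun r _ =>
    (next s).prob_nonneg _ _] at h0
  have h1 := h0 s (Finset.mem_univ s)
  rw [Finset.sum_eq_zero_iff_of_nonneg fun r _ => (next s).prob_nonneg _ _] at h1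
  exact h1 r (Finset.mem_univ r)

/-- At a guess at most one of the two states is nonzero; going backwards, the inner product before a
round is the sum of those after it. -/
theorem Protocol.NeverErrs.inner_eq_zero : ∀ {d : Fin n → ℕ} {P : Protocol G d} {B : Set G}
    {φ : G → GlobalSpace d} (_ : P.NeverErrs B φ) {i j : G} (_ : i ∈ B) (_ : j ∈ B) (_ : i ≠ j),
    inner ℂ (φ i) (φ j) = (0 : ℂ)
  | _, .guess g₀, B, φ, h, i, j, hi, hj, hij => by
      have key : ∀ l ∈ B, g₀ ≠ l → φ l = 0 := fun l hl hne => by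
        simpa [Protocol.prob] using h l hl g₀ hne
      by_cases hg : g₀ = i
      · rw [key j hj (hg ▸ hij), inner_zero_right]
      · rw [key i hi hg, inner_zero_left]
  | _, .round k _ hd _ _ K hK next, B, φ, h, i, j, hi, hj, hij => by
      rw [← sum_inner_liftOp k hd hK]
      exact Finset.sum_eq_zero fun s _ => Finset.sum_eq_zero fun r _ =>
        (h.next s r).inner_eq_zero hi hj hij

theorem LOCCDiscriminable.exists_neverErrs {J : Type*} [DecidableEq J] [Fintype J] {d : Fin n → ℕ}
    {ψ : J → ∀ k, EuclideanSpace ℂ (Fin (d k))} (hψ : ∀ j k, ‖ψ j k‖ = 1)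
    (h : LOCCDiscriminable ψ) :
    ∃ P : Protocol J d, P.NeverErrs Set.univ fun j => prodVec (ψ j) := by
  obtain ⟨P, hP⟩ := h
  refine ⟨P, fun j _ g hg => ?_⟩
  have hs := P.sum_prob (prodVec (ψ j))
  rw [norm_prodVec _ (hψ j), one_pow, ← Finset.add_sum_erase _ _ (Finset.mem_univ j), hP j] at hs
  refine (Finset.sum_eq_zero_iff_of_nonneg fun g _ => P.prob_nonneg _ _).1
    (by linarith : ∑ g ∈ Finset.univ.erase j, P.prob (prodVec (ψ j)) g = 0) g ?_
  exact Finset.mem_erase.2 ⟨hg, Finset.mem_univ g⟩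

end discrimination

/-! ### Local operations that keep the basis orthogonal -/

/-- A positive operator that is diagonal in two orthonormal bases without vanishing overlaps is
a multiple of the identity. -/
theorem exists_conjTranspose_mul_self_eq_smul_one {m p : ℕ} (M : Matrix (Fin m) (Fin p) ℂ)
    (V W : Matrix.unitaryGroup (Fin p) ℂ)
    (hVW : ∀ i j, ((W : Matrix (Fin p) (Fin p) ℂ)ᴴ * (V : Matrix (Fin p) (Fin p) ℂ)) i j ≠ 0)
    (hV : ∀ i j, i ≠ j → ((M * (V : Matrix (Fin p) (Fin p) ℂ))ᴴ * (M * V.1)) i j = 0)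
    (hW : ∀ i j, i ≠ j → ((M * (W : Matrix (Fin p) (Fin p) ℂ))ᴴ * (M * W.1)) i j = 0) :
    ∃ c : ℂ, Mᴴ * M = c • 1 := by
  obtain rfl | hp := Nat.eq_zero_or_pos p
  · exact ⟨0, Subsingleton.elim _ _⟩
  have hV1 : V.1 * V.1ᴴ = 1 := Matrix.mem_unitaryGroup_iff.1 V.2
  have hW1 : W.1 * W.1ᴴ = 1 := Matrix.mem_unitaryGroup_iff.1 W.2
  generalize hD : (M * V.1)ᴴ * (M * V.1) = D at hV
  generalize hD' : (M * W.1)ᴴ * (M * W.1) = D' at hW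
  -- `D` and `D'` are `Mᴴ * M` in the two bases, intertwined by the change of basis; its nonzero
  -- entries then equate all their diagonal entries.
  have hcomm : (W.1ᴴ * V.1) * D = D' * (W.1ᴴ * V.1) := by
    rw [← hD, ← hD', Matrix.conjTranspose_mul, Matrix.conjTranspose_mul]
    calc W.1ᴴ * V.1 * (V.1ᴴ * Mᴴ * (M * V.1))
        = W.1ᴴ * (V.1 * V.1ᴴ) * Mᴴ * M * V.1 := by simp only [Matrix.mul_assoc]
      _ = W.1ᴴ * Mᴴ * M * (W.1 * W.1ᴴ) * V.1 := by rw [hV1, hW1, mul_one, mul_one]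
      _ = _ := by simp only [Matrix.mul_assoc]
  have hdiag : ∀ i j, D j j = D' i i := by
    intro i j
    have h := congrFun (congrFun hcomm i) j
    rw [Matrix.mul_apply, Matrix.mul_apply, Finset.sum_eq_single j, Finset.sum_eq_single i,
      mul_comm] at h
    · exact mul_right_cancel₀ (hVW i j) h
    · intro b _ hb
      rw [hW i b hb.symm, zero_mul]
    · simp
    · intro b _ hb
      rw [hV b j hb, mul_zero]
    · simp
  have hscal : D = D' ⟨0, hp⟩ ⟨0, hp⟩ • (1 : Matrix (Fin p) (Fin p) ℂ) := by
    ext i j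
    by_cases hij : i = j
    · subst hij; simpa using hdiag _ _
    · simp [hV i j hij, hij]
  refine ⟨D' ⟨0, hp⟩ ⟨0, hp⟩, ?_⟩
  calc Mᴴ * M = (V.1 * V.1ᴴ) * (Mᴴ * M) * (V.1 * V.1ᴴ) := by rw [hV1, one_mul, mul_one]
    _ = V.1 * D * V.1ᴴ := by
        rw [← hD, Matrix.conjTranspose_mul]; simp only [Matrix.mul_assoc]
    _ = _ := by rw [hscal]; simp [hV1]

theorem inner_mulVec_mulVec {m p : ℕ} (M : Matrix (Fin m) (Fin p) ℂ)
    (u v : EuclideanSpace ℂ (Fin p)) :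
    (inner ℂ (WithLp.toLp 2 (M *ᵥ u.ofLp) : EuclideanSpace ℂ (Fin m))
      (WithLp.toLp 2 (M *ᵥ v.ofLp)) : ℂ) = star u.ofLp ⬝ᵥ ((Mᴴ * M) *ᵥ v.ofLp) := by
  rw [EuclideanSpace.inner_toLp_toLp, dotProduct_comm, Matrix.star_mulVec,
    ← Matrix.dotProduct_mulVec, Matrix.mulVec_mulVec]

theorem inner_mulVec_mulVec_of_eq_smul_one {m p : ℕ} {M : Matrix (Fin m) (Fin p) ℂ} {c : ℂ}
    (h : Mᴴ * M = c • 1) (u v : EuclideanSpace ℂ (Fin p)) :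
    (inner ℂ (WithLp.toLp 2 (M *ᵥ u.ofLp) : EuclideanSpace ℂ (Fin m))
      (WithLp.toLp 2 (M *ᵥ v.ofLp)) : ℂ) = c * inner ℂ u v := by
  rw [inner_mulVec_mulVec, h, Matrix.smul_mulVec, Matrix.one_mulVec, dotProduct_smul, smul_eq_mul,
    dotProduct_comm, ← EuclideanSpace.inner_toLp_toLp]

theorem exists_mulVec_ne_zero {m p N R : ℕ} {K : Fin N → Fin R → Matrix (Fin m) (Fin p) ℂ}
    (hK : ∑ s, ∑ r, (K s r)ᴴ * K s r = 1) {v : Fin p → ℂ} (hv : v ≠ 0) :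
    ∃ s r, K s r *ᵥ v ≠ 0 := by
  by_contra! h
  apply hv
  rw [← Matrix.one_mulVec v, ← hK, Matrix.sum_mulVec]
  refine Finset.sum_eq_zero fun s _ => ?_
  rw [Matrix.sum_mulVec]
  refine Finset.sum_eq_zero fun r _ => ?_
  rw [← Matrix.mulVec_mulVec, h, Matrix.mulVec_zero]

/-! ### No protocol distinguishes the states of the box -/

section

open scoped ComplexOrder

variable {n : ℕ} {d : Fin n → ℕ} {X : Fin n → Type*} {w : (∀ k, Fin (d k)) → ∀ k, X k}
  {U : ∀ k, X k → Matrix.unitaryGroup (Fin (d k)) ℂ}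

/-- Equal settings give the same vector, different ones are never orthogonal. So a party sending the
same in both cases cannot account for orthogonality. -/
theorem UnambiguousUnitaries.inner_encode_ne_zero (hU : UnambiguousUnitaries U)
    {a b : ∀ k, Fin (d k)} {k : Fin n} (h : a k = b k) :
    (inner ℂ (encode w U a k) (encode w U b k) : ℂ) ≠ 0 := by
  by_cases hx : w a k = w b k
  · rw [inner_encode_of_eq hx, if_pos h]
    exact one_ne_zero
  · rw [inner_encode]
    intro h0
    exact hx ((hU k _ _ _ _ fun e => hx (congrArg Prod.snd e).symm).1 h0)

/-- The global state into which the local operators `M` map the basis vector labelled by `a`. -/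
def evolved (w : (∀ k, Fin (d k)) → ∀ k, X k)
    (U : ∀ k, X k → Matrix.unitaryGroup (Fin (d k)) ℂ) {d' : Fin n → ℕ}
    (M : ∀ l, Matrix (Fin (d' l)) (Fin (d l)) ℂ) (a : ∀ k, Fin (d k)) : GlobalSpace d' :=
  prodVec fun l => WithLp.toLp 2 (M l *ᵥ (encode w U a l).ofLp)

/-- Local operators that keep the vectors of the parties in `S`, labelled by `z`, and that are
multiples of isometries for the other parties. -/
structure Uninformative (w : (∀ k, Fin (d k)) → ∀ k, X k)
    (U : ∀ k, X k → Matrix.unitaryGroup (Fin (d k)) ℂ) (S : Set (Fin n)) (z : ∀ k, Fin (d k))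
    {d' : Fin n → ℕ} (M : ∀ l, Matrix (Fin (d' l)) (Fin (d l)) ℂ) : Prop where
  ne_zero : ∀ l ∈ S, M l *ᵥ (encode w U z l).ofLp ≠ 0
  eq_smul_one : ∀ l, l ∉ S → ∃ c : ℂ, c ≠ 0 ∧ (M l)ᴴ * M l = c • 1

variable {S : Set (Fin n)} {z : ∀ k, Fin (d k)}

theorem Uninformative.inner_ne_zero (hU : UnambiguousUnitaries U)
    (hconst : ∀ k ∈ S, ∀ a, (∀ l ∈ S, a l = z l) → w a k = w z k) {d' : Fin n → ℕ}
    {M : ∀ l, Matrix (Fin (d' l)) (Fin (d l)) ℂ} (hM : Uninformative w U S z M)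
    {a b : ∀ k, Fin (d k)} (ha : ∀ l ∈ S, a l = z l) (hb : ∀ l ∈ S, b l = z l) {l : Fin n}
    (hl : a l = b l) :
    (inner ℂ (WithLp.toLp 2 (M l *ᵥ (encode w U a l).ofLp) : EuclideanSpace ℂ (Fin (d' l)))
      (WithLp.toLp 2 (M l *ᵥ (encode w U b l).ofLp)) : ℂ) ≠ 0 := by
  by_cases hlS : l ∈ S
  · rw [encode_congr (ha l hlS) (hconst l hlS a ha), encode_congr (hb l hlS) (hconst l hlS b hb)]
    rw [Ne, inner_self_eq_zero]
    exact fun h => hM.ne_zero l hlS (congrArg WithLp.ofLp h)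
  · obtain ⟨c, hc, hcM⟩ := hM.eq_smul_one l hlS
    rw [inner_mulVec_mulVec_of_eq_smul_one hcM]
    exact mul_ne_zero hc (hU.inner_encode_ne_zero hl)

/-- Induction on the protocol along one branch, chosen in each round so that the accumulated
operators `M` stay uninformative. -/
theorem Uninformative.not_neverErrs (hw : IsProcessFunction w) (hU : UnambiguousUnitaries U)
    (hd : ∀ k, 1 ≤ d k) (hS : ∃ k, k ∉ S)
    (hconst : ∀ k ∈ S, ∀ a, (∀ l ∈ S, a l = z l) → w a k = w z k)
    (hnon : ∀ k ∉ S, ∃ a, (∀ l ∈ S, a l = z l) ∧ w a k ≠ w z k) :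
    ∀ {d' : Fin n → ℕ} {M : ∀ l, Matrix (Fin (d' l)) (Fin (d l)) ℂ}
      (_ : Uninformative w U S z M) (P : Protocol (∀ k, Fin (d k)) d'),
      ¬ P.NeverErrs {a | ∀ l ∈ S, a l = z l} (evolved w U M)
  | _, M, hM, .guess g₀ => by
      intro h
      obtain ⟨k, hk⟩ := hS
      obtain ⟨a, ha, hak⟩ := hnon k hk
      -- The box contains `a` and `z`, which are distinct as `w a k ≠ w z k`; one of them is not the
      -- guess, yet its evolved state is nonzero.
      obtain ⟨b, hb, hbg⟩ : ∃ b : ∀ k, Fin (d k), (∀ l ∈ S, b l = z l) ∧ g₀ ≠ b := by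
        by_cases hg : g₀ = a
        · exact ⟨z, fun _ _ => rfl, fun e => hak (by rw [← hg, e])⟩
        · exact ⟨a, ha, hg⟩
      have h0 : evolved w U M b = 0 := by
        simpa [Protocol.prob] using h b hb g₀ hbg
      have h1 : (inner ℂ (evolved w U M b) (evolved w U M b) : ℂ) = 0 := by
        rw [h0, inner_zero_left]
      rw [evolved, inner_prodVec] at h1
      exact Finset.prod_ne_zero_iff.2 (fun l _ => hM.inner_ne_zero hU hconst hb hb rfl) h1
  | d', M, hM, .round k d'' hd' N R K hK next => by
      intro h
      let M' : Fin N → Fin R → ∀ l, Matrix (Fin (d'' l)) (Fin (d l)) ℂ :=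
        fun s r l => roundOp k (K s r) l * M l
      have hself : ∀ s r, M' s r k = K s r * M k := fun s r => by simp only [M', roundOp_self]
      have hne : ∀ s r l, l ≠ k → (M' s r l)ᴴ * M' s r l = (M l)ᴴ * M l := by
        intro s r l hl
        simp only [M', Matrix.conjTranspose_mul]
        rw [Matrix.mul_assoc, ← Matrix.mul_assoc _ (roundOp k (K s r) l) (M l),
          conjTranspose_roundOp_mul_roundOp hl (hd' l hl), Matrix.one_mul]
      have hnext : ∀ s r, (next s).NeverErrs {a | ∀ l ∈ S, a l = z l} (evolved w U (M' s r)) := by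
        intro s r
        have := h.next s r
        simp only [evolved, liftOp_mulVec_prodVec, Matrix.mulVec_mulVec] at this
        exact this
      have hM' : ∀ s r l, l ≠ k → (l ∈ S → M' s r l *ᵥ (encode w U z l).ofLp ≠ 0) ∧
          (l ∉ S → ∃ c : ℂ, c ≠ 0 ∧ (M' s r l)ᴴ * M' s r l = c • 1) := by
        refine fun s r l hl => ⟨fun hlS h0 => hM.ne_zero l hlS ?_, fun hlS => ?_⟩
        · rw [← Matrix.conjTranspose_mul_self_mulVec_eq_zero, ← hne s r l hl,
            Matrix.conjTranspose_mul_self_mulVec_eq_zero, h0]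
        · rw [hne s r l hl]
          exact hM.eq_smul_one l hlS
      by_cases hkS : k ∈ S
      · obtain ⟨s, r, hsr⟩ := exists_mulVec_ne_zero hK (hM.ne_zero k hkS)
        refine Uninformative.not_neverErrs hw hU hd hS hconst hnon (M := M' s r)
          ⟨fun l hl => ?_, fun l hl => ?_⟩ (next s) (hnext s r)
        · by_cases hlk : l = k
          · subst hlk
            rwa [hself, ← Matrix.mulVec_mulVec]
          · exact (hM' s r l hlk).1 hl
        · exact (hM' s r l (by rintro rfl; exact hl hkS)).2 hl
      · obtain ⟨c, hc, hcM⟩ := hM.eq_smul_one k hkS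
        -- Any nonzero vector would do: it only selects a branch in which `K s r * M k` is nonzero.
        have hv : M k *ᵥ Pi.single ⟨0, hd k⟩ 1 ≠ 0 := by
          rw [Ne, ← Matrix.conjTranspose_mul_self_mulVec_eq_zero, hcM, Matrix.smul_mulVec,
            Matrix.one_mulVec]
          simp [hc]
        obtain ⟨s, r, hsr⟩ := exists_mulVec_ne_zero hK hv
        -- Varying only the output of `k` keeps its setting and leaves all other overlaps nonzero,
        -- so `k` alone must carry the orthogonality.
        have hdiag : ∀ a : ∀ k, Fin (d k), (∀ l ∈ S, a l = z l) → ∀ i j, i ≠ j →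
            ((M' s r k * (U k (w a k)).1)ᴴ * (M' s r k * (U k (w a k)).1)) i j = 0 := by
          intro a ha i j hij
          have hmem : ∀ i, ∀ l ∈ S, Function.update a k i l = z l := by
            intro i l hl
            rw [Function.update_of_ne (by rintro rfl; exact hkS hl), ha l hl]
          have h0 := (hnext s r).inner_eq_zero (hmem i) (hmem j)
            fun e => hij (Function.update_injective a k e)
          rw [evolved, evolved, inner_prodVec, Finset.prod_eq_zero_iff] at h0
          obtain ⟨l, -, hl⟩ := h0
          obtain rfl : l = k := by
            by_contra hlk
            rw [inner_mulVec_mulVec, hne s r l hlk, ← inner_mulVec_mulVec] at hl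
            exact hM.inner_ne_zero hU hconst (hmem i) (hmem j)
              (by rw [Function.update_of_ne hlk, Function.update_of_ne hlk]) hl
          simp only [encode, hw.apply_update, Function.update_self, Matrix.mulVec_mulVec] at hl
          rwa [inner_mulVec_single] at hl
        obtain ⟨a, ha, hak⟩ := hnon k hkS
        obtain ⟨c', hc'⟩ := exists_conjTranspose_mul_self_eq_smul_one (M' s r k) (U k (w a k))
          (U k (w z k)) (fun i j h0 => hak
            ((hU k _ _ _ _ fun e => hak (congrArg Prod.snd e)).1 h0).symm)
          (hdiag a ha) (hdiag z fun _ _ => rfl)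
        have hc0 : c' ≠ 0 := by
          rintro rfl
          rw [zero_smul, Matrix.conjTranspose_mul_self_eq_zero, hself] at hc'
          rw [Matrix.mulVec_mulVec, hc', Matrix.zero_mulVec] at hsr
          exact hsr rfl
        refine Uninformative.not_neverErrs hw hU hd hS hconst hnon (M := M' s r)
          ⟨fun l hl => (hM' s r l (by rintro rfl; exact hkS hl)).1 hl, fun l hl => ?_⟩ (next s) (hnext s r)
        by_cases hlk : l = k
        · subst hlk
          exact ⟨c', hc0, hc'⟩
        · exact (hM' s r l hlk).2 hl

theorem not_LOCCDiscriminable_encode (hd : ∀ k, 1 ≤ d k) (hw : IsProcessFunction w)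
    (hU : UnambiguousUnitaries U) (hseq : ¬ IsSequential w) :
    ¬ LOCCDiscriminable (encode w U) := by
  intro h
  have : ∀ k, Nonempty (Fin (d k)) := fun k => ⟨⟨0, hd k⟩⟩
  obtain ⟨S, z, hS, hconst, hnon⟩ := exists_box_of_not_isSequential hseq
  obtain ⟨P, hP⟩ := h.exists_neverErrs norm_encode
  have hM : Uninformative w U S z fun l => (1 : Matrix (Fin (d l)) (Fin (d l)) ℂ) := by
    refine ⟨fun l _ h0 => ?_, fun l _ => ⟨1, one_ne_zero, by simp⟩⟩
    rw [Matrix.one_mulVec] at h0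
    have h1 := norm_encode (w := w) (U := U) z l
    rw [show encode w U z l = 0 from congrArg (WithLp.toLp 2) h0, norm_zero] at h1
    exact zero_ne_one h1
  refine hM.not_neverErrs hw hU hd hS hconst hnon P fun a _ g hg => ?_
  simp only [evolved, Matrix.one_mulVec]
  exact hP a trivial g hg

end

end ProcessQNLWE
end

theorem corollary2 {n : ℕ} (d : Fin n → ℕ) (hd : ∀ k, 1 ≤ d k)
    (X : Fin n → Type*) [∀ k, Fintype (X k)] [∀ k, DecidableEq (X k)]
    (w : (∀ k, Fin (d k)) → ∀ k, X k)
    (hw : ProcessQNLWE.IsProcessFunction w) (hnc : ¬ ProcessQNLWE.IsCausalProcess w) :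
    (∃ U : ∀ k, X k → Matrix.unitaryGroup (Fin (d k)) ℂ,
      ProcessQNLWE.UnambiguousUnitaries U) ∧
    ∀ U : ∀ k, X k → Matrix.unitaryGroup (Fin (d k)) ℂ,
      ProcessQNLWE.UnambiguousUnitaries U →
        ProcessQNLWE.IsCompleteProductBasis (ProcessQNLWE.encode w U) ∧
        ProcessQNLWE.IsUnambiguous (ProcessQNLWE.encode w U) (fun a => a) w ∧
        ProcessQNLWE.IsQNLWE (ProcessQNLWE.encode w U) := by
  have : ∀ k, Nonempty (Fin (d k)) := fun k => ⟨⟨0, hd k⟩⟩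
  have hseq : ¬ ProcessQNLWE.IsSequential w := fun h =>
    hnc fun I O _ _ _ M hM => h.isCausalCorrelation I O M hM
  refine ⟨ProcessQNLWE.exists_unambiguousUnitaries d hd X, fun U hU =>
    ⟨hw.isCompleteProductBasis, hU.isUnambiguous, hw.isCompleteProductBasis.orthonormal,
      ProcessQNLWE.not_LOCCDiscriminable_encode hd hw hU hseq⟩⟩
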